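/- Let $\omega$ be the set of natural numbers and give Baire space $\omega^\omega$ the product topology of the discrete topology on $\omega$. A Turing functional $\Phi$ is given by a recursively enumerable set $W$ of triples $(\sigma,n,m)$ ($\sigma$ a finite string, $n,m\in\omega$) that is consistent: if $(\sigma,n,m),(\tau,n,m')\in W$ and $\sigma$ is an initial segment of $\tau$, then $m=m'$; for $f\in\omega^\omega$, $\Phi(f)(n)=m$ means that $(\sigma,n,m)\in W$ for some initial segment $\sigma$ of $f$. For $\mathcal P,\mathcal Q\subseteq\omega^\omega$, write $\mathcal P\le_{\mathrm s}\mathcal Q$ (Medvedev reducibility) if there is a Turing functional $\Phi$ such that for every $f\in\mathcal Q$, $\Phi(f)$ is total and belongs to $\mathcal P$; write $\mathcal P\equiv_{\mathrm s}\mathcal Q$ if $\mathcal P\le_{\mathrm s}\mathcal Q$ and $\mathcal Q\le_{\mathrm s}\mathcal P$. The Medvedev degree of $\mathcal P$ is its $\equiv_{\mathrm s}$-class; a Medvedev degree is compact if it is the degree of a compact subset of $\omega^\omega$. For $A,B\subseteq\omega$, write $A\le_{\mathrm e} B$ (enumeration reducibility) if there is a recursively enumerable set $V$ of pairs $(x,D)$,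 with $x\in\omega$ and $D\subseteq\omega$ finite, such that $A=\{x:\exists D\,((x,D)\in V\text{ and }D\subseteq B)\}$; the enumeration degree of $A$ is the class of all $B$ with $B\le_{\mathrm e}A$ and $A\le_{\mathrm e}B$. An enumeration degree is cototal if it contains a set $B$ with $B\le_{\mathrm e}\omega\setminus B$. For nonempty $A\subseteq\omega$, let $\mathbf E_A$ be the Medvedev degree of $\mathcal E_A=\{f\in\omega^\omega:\operatorname{ran}(f)=A\}$. The degrees of enumerability are the Medvedev degrees of the form $\mathbf E_A$ with $A\subseteq\omega$ nonempty. A degree of enumerability is called cototal if it equals $\mathbf E_A$ for some nonempty $A\subseteq\omega$ whose enumeration degree is cototal. **Theorem.** For every nonempty $A\subseteq\omega$, $\mathbf E_A$ is compact if and only if the enumeration degree of $A$ is cototal. Hence a degree of enumerability is compact if and only if it is cototal. -/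

import Mathlib

/-! ### Turing functionals and the Medvedev degrees -/

/-- A Turing functional on Baire space, presented by its recursively enumerable, consistent set of
computation axioms: `(σ, n, m)` says that the computation which consults only the finite part `σ`
of the oracle halts on input `n` with output `m`. -/
structure TuringFunctional where
  /-- the set of axioms `(σ, n, m)` -/
  axs : Set (List ℕ × ℕ × ℕ)
  re : REPred fun p : List ℕ × ℕ × ℕ => p ∈ axs
  consistent : ∀ (σ τ : List ℕ) (n m m' : ℕ), σ <+: τ →
    (σ, n, m) ∈ axs → (τ, n, m') ∈ axs → m = m'

/-- `Φ(f)(n)` is defined and equal to `m`: some initial segment `f ↾ k` of the oracle carries an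
axiom for input `n` and output `m`. -/
def TuringFunctional.Computes (Φ : TuringFunctional) (f : ℕ → ℕ) (n m : ℕ) : Prop :=
  ∃ k : ℕ, ((List.range k).map f, n, m) ∈ Φ.axs

/-- A mass problem is a subset of Baire space. -/
abbrev MassProblem : Type := Set (ℕ → ℕ)

/-- Medvedev (strong) reducibility `P ≤ₛ Q`: there is one Turing functional `Φ` such that `Φ(f)` is
total and belongs to `P` for every `f ∈ Q`. -/
def MedvedevReducible (P Q : MassProblem) : Prop :=
  ∃ Φ : TuringFunctional, ∀ f ∈ Q, ∃ g ∈ P, ∀ n : ℕ, Φ.Computes f n (g n)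

/-- Medvedev (strong) equivalence. -/
def MedvedevEquiv (P Q : MassProblem) : Prop :=
  MedvedevReducible P Q ∧ MedvedevReducible Q P

/-- The Medvedev degree of a mass problem: its equivalence class. -/
def medvedevDegree (P : MassProblem) : Set MassProblem :=
  {Q | MedvedevEquiv Q P}

/-- A Medvedev degree is compact if it is the degree of a compact subset of Baire space
(`ℕ → ℕ` with the product topology of the discrete topology on `ℕ`). -/
def IsCompactDegree (d : Set MassProblem) : Prop :=
  ∃ C : MassProblem, IsCompact C ∧ d = medvedevDegree C

/-! ### Enumeration operators and the enumeration degrees -/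

/-- An enumeration operator, presented by a recursively enumerable set of axioms `(x, D)` with `D`
a finite set of natural numbers, listed by a list. -/
structure EnumOperator where
  /-- the set of axioms `(x, D)` -/
  axs : Set (ℕ × List ℕ)
  re : REPred fun p : ℕ × List ℕ => p ∈ axs

/-- `Ψ(B)`: the set of all `x` with an axiom `(x, D)` such that `D ⊆ B`. -/
def EnumOperator.apply (Ψ : EnumOperator) (B : Set ℕ) : Set ℕ :=
  {x | ∃ D : List ℕ, (x, D) ∈ Ψ.axs ∧ ∀ d ∈ D, d ∈ B}

/-- Enumeration reducibility `A ≤ₑ B`. -/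
def EnumReducible (A B : Set ℕ) : Prop :=
  ∃ Ψ : EnumOperator, Ψ.apply B = A

/-- Enumeration equivalence. -/
def EnumEquiv (A B : Set ℕ) : Prop :=
  EnumReducible A B ∧ EnumReducible B A

/-- The enumeration degree of a set: its equivalence class. -/
def enumDegree (A : Set ℕ) : Set (Set ℕ) :=
  {B | EnumEquiv B A}

/-- A set is cototal if it is enumeration reducible to its complement. -/
def IsCototalSet (A : Set ℕ) : Prop :=
  EnumReducible A Aᶜ

/-- An enumeration degree is cototal if it contains a cototal set. -/
def IsCototalEnumDegree (a : Set (Set ℕ)) : Prop :=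
  ∃ B ∈ a, IsCototalSet B

/-! ### Degrees of enumerability -/

/-- The problem of enumerability of `A`: the set of all functions with range `A`. -/
def enumProblem (A : Set ℕ) : MassProblem :=
  {f | Set.range f = A}

/-- The Medvedev degree of the problem of enumerability of `A`. -/
def enumerabilityDegree (A : Set ℕ) : Set MassProblem :=
  medvedevDegree (enumProblem A)

/-- The degrees of enumerability: the Medvedev degrees of the problems of enumerability of
nonempty sets. -/
def IsDegreeOfEnumerability (d : Set MassProblem) : Prop :=
  ∃ A : Set ℕ, A.Nonempty ∧ d = enumerabilityDegree A

/-- A degree of enumerability is cototal if it is that of a nonempty set whose enumeration degree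
is cototal. -/
def IsCototalDegreeOfEnumerability (d : Set MassProblem) : Prop :=
  ∃ A : Set ℕ, A.Nonempty ∧ d = enumerabilityDegree A ∧ IsCototalEnumDegree (enumDegree A)

/-! Cototal implies compact. Replace `A` by a nonempty cototal `B` in its enumeration degree,
enumerated from `Bᶜ` by axioms `(x, D)`. For each axiom some element of `D ∪ {x}` lies in `B`, since
`D ⊆ Bᶜ` puts `x` into `B`. Choosing such an element for every axiom enumerates exactly `B`: each `x
∈ B` has an axiom with `D ⊆ Bᶜ`, which forces the choice of `x`. The choices form a product of
finite sets, and an enumeration of `B` computes one by waiting (`IsCototalSet.exists_isCompact`).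

Compact implies cototal. Let `C` be compact and equivalent to `enumProblem A`; passing to graphs
makes `C` binary. Let `Ψ` map enumerations of `A` into `C`, and `Φ` map `C` to enumerations of `A`.
Let `T` be the set of strings that `Ψ` computes from finite strings over `A`. Such finite strings
extend to enumerations of `A`, so `T` consists of initial segments of members of `C`, and it
contains all those of some member; hence `T` and `A` are enumeration equivalent. Moreover `x ∈ T`
iff for some `l` every binary string of length `l` is outside `T` or makes `Φ` produce enough of `A`
to put `x` into `T`. Compactness gives the forward direction, a string of length `l` in `T` the
converse. This consults only the complement of `T`, so `T` is cototal
(`isCototalSet_stringOperator_apply`). -/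

/-! ### Closure properties of recursively enumerable predicates -/

section RecursivelyEnumerable

variable {α β : Type*} [Primcodable α] [Primcodable β]

-- Stages are step-bounded runs of a code. Their monotonicity in `s` lets finitely many conditions
-- be verified at one common stage.
open Nat.Partrec in
theorem REPred.exists_primrec_stages {p : α → Prop} (hp : REPred p) :
    ∃ R : α → ℕ → Prop, PrimrecRel R ∧ (∀ a s t, s ≤ t → R a s → R a t) ∧
      ∀ a, p a ↔ ∃ s, R a s := by
  obtain ⟨c, hc⟩ := Code.exists_code.1 hp
  refine ⟨fun a s => (Code.evaln s c (Encodable.encode a)).isSome = true, ?_, ?_, ?_⟩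
  · have h : Primrec fun q : α × ℕ => (Code.evaln q.2 c (Encodable.encode q.1)).isSome :=
      Primrec.option_isSome.comp (Code.primrec_evaln.comp
        ((Primrec.snd.pair (Primrec.const c)).pair (Primrec.encode.comp Primrec.fst)))
    exact Primrec.eq.comp h (Primrec.const true)
  · intro a s t hst h
    obtain ⟨x, hx⟩ := Option.isSome_iff_exists.1 h
    exact Option.isSome_iff_exists.2 ⟨x, Code.evaln_mono hst hx⟩
  · intro a
    have key : p a ↔ (Code.eval c (Encodable.encode a)).Dom := by
      rw [hc]
      simp [Part.assert]
    rw [key, Part.dom_iff_mem]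
    constructor
    · rintro ⟨x, hx⟩
      obtain ⟨s, hs⟩ := Code.evaln_complete.1 hx
      exact ⟨s, Option.isSome_iff_exists.2 ⟨x, hs⟩⟩
    · rintro ⟨s, hs⟩
      obtain ⟨x, hx⟩ := Option.isSome_iff_exists.1 hs
      exact ⟨x, Code.evaln_complete.2 ⟨s, hx⟩⟩

theorem REPred.of_primrecRel {R : α → ℕ → Prop} (hR : PrimrecRel R) :
    REPred fun a => ∃ s, R a s := by
  classical
  have h : Computable₂ fun (a : α) (s : ℕ) => decide (R a s) := hR.decide.to_comp
  refine (Partrec.dom_re (Partrec.rfind (p := fun a s => Part.some (decide (R a s)))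
    h.partrec₂)).of_eq fun a => ?_
  refine Nat.rfind_dom.trans ?_
  simp

theorem PrimrecPred.rePred {p : α → Prop} (hp : PrimrecPred p) : REPred p :=
  hp.computablePred.to_re

theorem REPred.comp {p : β → Prop} (hp : REPred p) {f : α → β} (hf : Primrec f) :
    REPred fun a => p (f a) :=
  Partrec.comp hp hf.to_comp

theorem REPred.exists {p : α → β → Prop} (hp : REPred fun x : α × β => p x.1 x.2) :
    REPred fun a => ∃ b, p a b := by
  obtain ⟨R, hR, -, hpR⟩ := hp.exists_primrec_stages
  -- Dovetailing: `n` codes a candidate witness together with a stage.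
  have hS : PrimrecRel fun (a : α) (n : ℕ) =>
      ∃ b ∈ (Encodable.decode (α := β) n.unpair.1).toList, R (a, b) n.unpair.2 := by
    have h1 : PrimrecRel fun (b : β) (y : α × ℕ) => R (y.1, b) y.2 :=
      hR.comp ((Primrec.fst.comp Primrec.snd).pair Primrec.fst) (Primrec.snd.comp Primrec.snd)
    have hu : Primrec fun x : α × ℕ => x.2.unpair := Primrec.unpair.comp Primrec.snd
    exact h1.exists_mem_list.comp
      (Primrec.optionToList.comp (Primrec.decode.comp (Primrec.fst.comp hu)))
      (Primrec.fst.pair (Primrec.snd.comp hu))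
  refine (REPred.of_primrecRel hS).of_eq fun a => ?_
  constructor
  · rintro ⟨n, b, -, h⟩
    exact ⟨b, (hpR (a, b)).2 ⟨_, h⟩⟩
  · rintro ⟨b, h⟩
    obtain ⟨s, hs⟩ := (hpR (a, b)).1 h
    exact ⟨Nat.pair (Encodable.encode b) s, b, by simp, by simpa using hs⟩

theorem REPred.and {p q : α → Prop} (hp : REPred p) (hq : REPred q) :
    REPred fun a => p a ∧ q a := by
  obtain ⟨R, hR, hRm, hpR⟩ := hp.exists_primrec_stages
  obtain ⟨S, hS, hSm, hqS⟩ := hq.exists_primrec_stages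
  have h : PrimrecRel fun a s => R a s ∧ S a s := PrimrecPred.and hR hS
  refine (REPred.of_primrecRel h).of_eq fun a => ?_
  rw [hpR, hqS]
  constructor
  · rintro ⟨s, h1, h2⟩
    exact ⟨⟨s, h1⟩, ⟨s, h2⟩⟩
  · rintro ⟨⟨s, h1⟩, ⟨t, h2⟩⟩
    exact ⟨max s t, hRm _ _ _ (le_max_left _ _) h1, hSm _ _ _ (le_max_right _ _) h2⟩

theorem REPred.or {p q : α → Prop} (hp : REPred p) (hq : REPred q) :
    REPred fun a => p a ∨ q a := by
  obtain ⟨R, hR, -, hpR⟩ := hp.exists_primrec_stages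
  obtain ⟨S, hS, -, hqS⟩ := hq.exists_primrec_stages
  have h : PrimrecRel fun a s => R a s ∨ S a s := PrimrecPred.or hR hS
  refine (REPred.of_primrecRel h).of_eq fun a => ?_
  rw [hpR, hqS, exists_or]

theorem REPred.forall_mem_list {p : β → α → Prop} (hp : REPred fun x : β × α => p x.1 x.2) :
    REPred fun y : List β × α => ∀ b ∈ y.1, p b y.2 := by
  obtain ⟨R, hR, hRm, hpR⟩ := hp.exists_primrec_stages
  have hS : PrimrecRel fun (y : List β × α) (s : ℕ) => ∀ b ∈ y.1, R (b, y.2) s := by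
    have h1 : PrimrecRel fun (b : β) (y : α × ℕ) => R (b, y.1) y.2 :=
      hR.comp (Primrec.fst.pair (Primrec.fst.comp Primrec.snd)) (Primrec.snd.comp Primrec.snd)
    exact h1.forall_mem_list.comp (Primrec.fst.comp Primrec.fst)
      ((Primrec.snd.comp Primrec.fst).pair Primrec.snd)
  refine (REPred.of_primrecRel hS).of_eq ?_
  rintro ⟨L, a⟩
  constructor
  · rintro ⟨s, h⟩ b hb
    exact (hpR (b, a)).2 ⟨s, h b hb⟩
  · intro h
    dsimp only at h ⊢
    induction L with
    | nil => exact ⟨0, by simp⟩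
    | cons b L ih =>
      obtain ⟨s, hs⟩ := ih fun c hc => h c (List.mem_cons_of_mem _ hc)
      obtain ⟨t, ht⟩ := (hpR (b, a)).1 (h b List.mem_cons_self)
      refine ⟨max s t, fun c hc => ?_⟩
      rcases List.mem_cons.1 hc with rfl | hc
      · exact hRm _ _ _ (le_max_right _ _) ht
      · exact hRm _ _ _ (le_max_left _ _) (hs c hc)

/-- The elements satisfying a recursively enumerable predicate can be listed by a primitive
recursive sequence of options. -/
theorem REPred.exists_primrec_enum {p : α → Prop} (hp : REPred p) :
    ∃ e : ℕ → Option α, Primrec e ∧ ∀ a, p a ↔ ∃ n, e n = some a := by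
  classical
  obtain ⟨R, hR, -, hpR⟩ := hp.exists_primrec_stages
  refine ⟨fun n => (Encodable.decode (α := α) n.unpair.1).bind
    fun a => if R a n.unpair.2 then some a else none, ?_, fun a => ?_⟩
  · refine Primrec.option_bind (Primrec.decode.comp (Primrec.fst.comp Primrec.unpair)) ?_
    refine Primrec.ite ?_ (Primrec.option_some.comp Primrec.snd) (Primrec.const none)
    exact hR.comp Primrec.snd (Primrec.snd.comp (Primrec.unpair.comp Primrec.fst))
  · rw [hpR]
    constructor
    · rintro ⟨s, hs⟩
      exact ⟨Nat.pair (Encodable.encode a) s, by simp [hs]⟩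
    · rintro ⟨n, hn⟩
      obtain ⟨b, -, hb⟩ := Option.bind_eq_some_iff.1 hn
      split_ifs at hb with h
      cases hb
      exact ⟨_, h⟩

theorem primrecRel_list_mem : PrimrecRel fun (l : List α) (a : α) => a ∈ l := by
  have h : PrimrecRel fun (l : List α) (a : α) => ∃ c ∈ l, c = a :=
    PrimrecRel.exists_mem_list Primrec.eq
  exact h.of_eq (by simp)

end RecursivelyEnumerable

/-! ### Initial segments -/

/-- The initial segment `f ↾ k` of length `k`. -/
abbrev initSeg (f : ℕ → ℕ) (k : ℕ) : List ℕ := (List.range k).map f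

theorem take_initSeg (f : ℕ → ℕ) (j k : ℕ) : (initSeg f k).take j = initSeg f (min j k) := by
  rw [initSeg, ← List.map_take, List.take_range]

theorem take_initSeg_of_le (f : ℕ → ℕ) {j k : ℕ} (h : j ≤ k) :
    (initSeg f k).take j = initSeg f j := by
  rw [take_initSeg, min_eq_left h]

theorem length_initSeg (f : ℕ → ℕ) (k : ℕ) : (initSeg f k).length = k := by simp

theorem getD_initSeg (f : ℕ → ℕ) {i k : ℕ} (h : i < k) : (initSeg f k).getD i 0 = f i := by
  simp [List.getD, h]

theorem mem_initSeg {f : ℕ → ℕ} {k m : ℕ} : m ∈ initSeg f k ↔ ∃ i < k, f i = m := by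
  simp [initSeg]

theorem initSeg_prefix (f : ℕ → ℕ) {j k : ℕ} (h : j ≤ k) : initSeg f j <+: initSeg f k := by
  rw [← take_initSeg_of_le f h]
  exact List.take_prefix _ _

theorem exists_forall_mem_initSeg {f : ℕ → ℕ} {D : List ℕ} (h : ∀ d ∈ D, d ∈ Set.range f) :
    ∃ k, ∀ d ∈ D, d ∈ initSeg f k := by
  induction D with
  | nil => exact ⟨0, by simp⟩
  | cons d D ih =>
    obtain ⟨k, hk⟩ := ih fun c hc => h c (List.mem_cons_of_mem _ hc)
    obtain ⟨i, hi⟩ := h d List.mem_cons_self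
    refine ⟨max k (i + 1), fun c hc => ?_⟩
    rcases List.mem_cons.1 hc with rfl | hc
    · exact mem_initSeg.2 ⟨i, by omega, hi⟩
    · exact (initSeg_prefix f (le_max_left _ _)).subset (hk c hc)

/-! ### Turing functionals applied to strings -/

namespace TuringFunctional

/-- `Φ.Maps f g` says that `Φ(f)` is total and equal to `g`. -/
def Maps (Φ : TuringFunctional) (f g : ℕ → ℕ) : Prop := ∀ n, Φ.Computes f n (g n)

/-- `Φ.Yields ρ σ` says that `Φ`, using only the oracle information `ρ`, computes the string
`σ`. -/
def Yields (Φ : TuringFunctional) (ρ σ : List ℕ) : Prop :=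
  ∀ i ∈ List.range σ.length, ∃ k, (ρ.take k, i, σ.getD i 0) ∈ Φ.axs

theorem Computes.unique {Φ : TuringFunctional} {f : ℕ → ℕ} {n m m' : ℕ}
    (h : Φ.Computes f n m) (h' : Φ.Computes f n m') : m = m' := by
  obtain ⟨k, hk⟩ := h
  obtain ⟨l, hl⟩ := h'
  rcases le_total k l with hkl | hkl
  · exact Φ.consistent _ _ _ _ _ (initSeg_prefix f hkl) hk hl
  · exact (Φ.consistent _ _ _ _ _ (initSeg_prefix f hkl) hl hk).symm

theorem rePred_yields (Φ : TuringFunctional) :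
    REPred fun p : List ℕ × List ℕ => Φ.Yields p.1 p.2 := by
  have h1 : REPred fun x : (ℕ × List ℕ × List ℕ) × ℕ =>
      (x.1.2.1.take x.2, x.1.1, x.1.2.2.getD x.1.1 0) ∈ Φ.axs := by
    have a : Primrec fun x : (ℕ × List ℕ × List ℕ) × ℕ => x.1.2 :=
      Primrec.snd.comp Primrec.fst
    have b : Primrec fun x : (ℕ × List ℕ × List ℕ) × ℕ => x.1.1 :=
      Primrec.fst.comp Primrec.fst
    exact Φ.re.comp ((Primrec.list_take.comp Primrec.snd (Primrec.fst.comp a)).pair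
      (b.pair ((Primrec.list_getD 0).comp (Primrec.snd.comp a) b)))
  have h2 : REPred fun x : ℕ × List ℕ × List ℕ =>
      ∃ k, (x.2.1.take k, x.1, x.2.2.getD x.1 0) ∈ Φ.axs := REPred.exists h1
  exact (REPred.forall_mem_list (p := fun i (x : List ℕ × List ℕ) =>
    ∃ k, (x.1.take k, i, x.2.getD i 0) ∈ Φ.axs) h2).comp
    ((Primrec.list_range.comp (Primrec.list_length.comp Primrec.snd)).pair Primrec.id)

/-- Every prefix consulted is also a prefix of `f`, so by consistency the computed values are those
of `g`. -/
theorem Yields.eq_initSeg {Φ : TuringFunctional} {f g : ℕ → ℕ} {k : ℕ} {σ : List ℕ}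
    (h : Φ.Yields (initSeg f k) σ) (hfg : Φ.Maps f g) : σ = initSeg g σ.length := by
  refine List.ext_getElem (by simp) fun i hi _ => ?_
  obtain ⟨j, hj⟩ := h i (List.mem_range.2 hi)
  rw [take_initSeg] at hj
  have := Computes.unique (Φ := Φ) (f := f) ⟨_, hj⟩ (hfg i)
  simpa [List.getD, hi] using this

theorem Maps.exists_yields {Φ : TuringFunctional} {f g : ℕ → ℕ} (hfg : Φ.Maps f g) (l : ℕ) :
    ∃ k, Φ.Yields (initSeg f k) (initSeg g l) := by
  choose u hu using hfg
  refine ⟨(Finset.range l).sup u, fun i hi => ⟨u i, ?_⟩⟩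
  rw [length_initSeg, List.mem_range] at hi
  rw [take_initSeg_of_le f (Finset.le_sup (f := u) (Finset.mem_range.2 hi)), getD_initSeg g hi]
  exact hu i

end TuringFunctional

/-! ### Medvedev reductions from recursively enumerable relations -/

/-- A recursively enumerable relation between finite oracle strings, inputs and outputs, which need
not be consistent, can be uniformized to a Turing functional. -/
theorem MedvedevReducible.of_rePred {P Q : MassProblem} {W : List ℕ × ℕ × ℕ → Prop}
    (hW : REPred W) (htotal : ∀ f ∈ Q, ∀ n, ∃ k m, W (initSeg f k, n, m))
    (hmem : ∀ f ∈ Q, ∀ g : ℕ → ℕ, (∀ n, ∃ k, W (initSeg f k, n, g n)) → g ∈ P) :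
    MedvedevReducible P Q := by
  classical
  obtain ⟨R, hR, -, hWR⟩ := hW.exists_primrec_stages
  -- `S j (σ, n)`: the search step `j = ⟨k, m, s⟩` succeeds on oracle string `σ` and input `n`
  let S : ℕ → List ℕ × ℕ → Prop := fun j x =>
    R (x.1.take j.unpair.1, x.2, j.unpair.2.unpair.1) j.unpair.2.unpair.2
  have hS : PrimrecRel S := by
    have u : Primrec fun x : ℕ × List ℕ × ℕ => x.1.unpair := Primrec.unpair.comp Primrec.fst
    have v : Primrec fun x : ℕ × List ℕ × ℕ => x.1.unpair.2.unpair :=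
      Primrec.unpair.comp (Primrec.snd.comp u)
    exact hR.comp ((Primrec.list_take.comp (Primrec.fst.comp u)
      (Primrec.fst.comp Primrec.snd)).pair ((Primrec.snd.comp Primrec.snd).pair
        (Primrec.fst.comp v))) (Primrec.snd.comp v)
  -- Step `j` reads at most `j` oracle entries, so extending a string of length at least `j` does
  -- not change its outcome.
  have hS_take : ∀ j (σ τ : List ℕ) n, σ <+: τ → j ≤ σ.length → (S j (σ, n) ↔ S j (τ, n)) := by
    rintro j σ _ n ⟨t, rfl⟩ hj
    have : j.unpair.1 ≤ σ.length := (Nat.unpair_left_le j).trans hj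
    simp only [S, List.take_append_of_le_length this]
  -- The output is that of the least successful step. The bound `j ≤ x.1.length` makes this choice
  -- stable under extension, which gives consistency.
  let axs : Set (List ℕ × ℕ × ℕ) := {x | ∃ j, j ≤ x.1.length ∧ S j (x.1, x.2.1) ∧
    x.2.2 = j.unpair.2.unpair.1 ∧ ∀ i < j, ¬ S i (x.1, x.2.1)}
  have haxs : REPred fun x => x ∈ axs := by
    have c : Primrec fun y : (List ℕ × ℕ × ℕ) × ℕ => (y.1.1, y.1.2.1) :=
      (Primrec.fst.comp Primrec.fst).pair (Primrec.fst.comp (Primrec.snd.comp Primrec.fst))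
    refine REPred.of_primrecRel (R := fun (x : List ℕ × ℕ × ℕ) j => j ≤ x.1.length ∧ S j (x.1, x.2.1) ∧
      x.2.2 = j.unpair.2.unpair.1 ∧ ∀ i < j, ¬ S i (x.1, x.2.1)) ?_
    refine PrimrecPred.and ?_ (PrimrecPred.and ?_ (PrimrecPred.and ?_ ?_))
    · exact Primrec.nat_le.comp Primrec.snd
        (Primrec.list_length.comp (Primrec.fst.comp Primrec.fst))
    · exact hS.comp Primrec.snd c
    · exact Primrec.eq.comp (Primrec.snd.comp (Primrec.snd.comp Primrec.fst))
        (Primrec.fst.comp (Primrec.unpair.comp (Primrec.snd.comp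
          (Primrec.unpair.comp Primrec.snd))))
    · have hN : PrimrecRel fun i x => ¬ S i x := PrimrecPred.not hS
      exact (hN.forall_mem_list.comp (Primrec.list_range.comp Primrec.snd) c).of_eq (by simp)
  refine ⟨⟨axs, haxs, ?_⟩, fun f hf => ?_⟩
  · rintro σ τ n m m' hστ ⟨j, hj, hjS, rfl, hjmin⟩ ⟨j', hj', hjS', rfl, hjmin'⟩
    dsimp only at *
    have hl := hστ.length_le
    rcases lt_trichotomy j j' with h | rfl | h
    · exact absurd ((hS_take j σ τ n hστ hj).1 hjS) (hjmin' j h)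
    · rfl
    · exact absurd ((hS_take j' σ τ n hστ (h.le.trans hj)).2 hjS') (hjmin j' h)
  · have key : ∀ n, ∃ m k, W (initSeg f k, n, m) ∧ ∃ l, (initSeg f l, n, m) ∈ axs := by
      intro n
      have hex : ∃ j, S j (initSeg f j, n) := by
        obtain ⟨k, m, hW'⟩ := htotal f hf n
        obtain ⟨s, hs⟩ := (hWR _).1 hW'
        refine ⟨Nat.pair k (Nat.pair m s), ?_⟩
        simpa only [S, Nat.unpair_pair, take_initSeg_of_le f (Nat.left_le_pair k _)] using hs
      have hj := Nat.find_spec hex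
      have hmin := fun i => Nat.find_min hex (m := i)
      set j := Nat.find hex
      refine ⟨j.unpair.2.unpair.1, j.unpair.1, ?_, j, j, by simp, hj, rfl, fun i hi h => ?_⟩
      · rw [hWR]
        refine ⟨j.unpair.2.unpair.2, ?_⟩
        simpa only [S, take_initSeg_of_le f (Nat.unpair_left_le j)] using hj
      -- An earlier success on `initSeg f j` would already be one on `initSeg f i`, against the
      -- minimality of `j`.
      · exact hmin i hi ((hS_take i _ _ n (initSeg_prefix f hi.le) (by simp)).2 h)
    choose g u hu l hl using key
    exact ⟨g, hmem f hf g fun n => ⟨u n, hu n⟩, fun n => ⟨l n, hl n⟩⟩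

theorem MedvedevReducible.of_subset {P Q : MassProblem} (h : Q ⊆ P) : MedvedevReducible P Q := by
  refine .of_rePred (W := fun x => x.1[x.2.1]? = some x.2.2) (PrimrecPred.rePred ?_) ?_ ?_
  · exact Primrec.eq.comp (Primrec.list_getElem?.comp Primrec.fst (Primrec.fst.comp Primrec.snd))
      (Primrec.option_some.comp (Primrec.snd.comp Primrec.snd))
  · exact fun f _ n => ⟨n + 1, f n, by simp⟩
  · intro f hf g hg
    have : g = f := by
      funext n
      obtain ⟨k, hk⟩ := hg n
      simp only [List.getElem?_map, Option.map_eq_some_iff] at hk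
      obtain ⟨i, hi, hgi⟩ := hk
      rw [List.getElem?_eq_some_iff] at hi
      obtain ⟨hi, rfl⟩ := hi
      simpa using hgi.symm
    exact h (this ▸ hf)

theorem MedvedevReducible.trans {P Q R : MassProblem} (h₁ : MedvedevReducible P Q)
    (h₂ : MedvedevReducible Q R) : MedvedevReducible P R := by
  obtain ⟨Φ, hΦ⟩ := h₁
  obtain ⟨Ψ, hΨ⟩ := h₂
  refine .of_rePred (W := fun x => ∃ σ, (σ, x.2) ∈ Φ.axs ∧ Ψ.Yields x.1 σ) ?_ ?_ ?_
  · exact REPred.exists ((Φ.re.comp (Primrec.snd.pair (Primrec.snd.comp Primrec.fst))).and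
      (Ψ.rePred_yields.comp ((Primrec.fst.comp Primrec.fst).pair Primrec.snd)))
  · intro f hf n
    obtain ⟨g, hg, hfg⟩ := hΨ f hf
    obtain ⟨h, -, hgh⟩ := hΦ g hg
    obtain ⟨l, hl⟩ := hgh n
    obtain ⟨k, hk⟩ := TuringFunctional.Maps.exists_yields hfg l
    exact ⟨k, h n, initSeg g l, hl, hk⟩
  · intro f hf h' hh'
    obtain ⟨g, hg, hfg⟩ := hΨ f hf
    obtain ⟨h, hh, hgh⟩ := hΦ g hg
    have : h' = h := by
      funext n
      obtain ⟨k, σ, hσ, hk⟩ := hh' n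
      have hσ' : σ = initSeg g σ.length := hk.eq_initSeg hfg
      rw [hσ'] at hσ
      exact TuringFunctional.Computes.unique ⟨_, hσ⟩ (hgh n)
    exact this ▸ hh

theorem medvedevDegree_eq_iff {P Q : MassProblem} :
    medvedevDegree P = medvedevDegree Q ↔ MedvedevEquiv P Q := by
  constructor
  · intro h
    have : P ∈ medvedevDegree P := ⟨.of_subset subset_rfl, .of_subset subset_rfl⟩
    rwa [h] at this
  · rintro ⟨h1, h2⟩
    ext X
    exact ⟨fun ⟨a, b⟩ => ⟨a.trans h1, h2.trans b⟩, fun ⟨a, b⟩ => ⟨a.trans h2, h1.trans b⟩⟩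

/-! ### Problems of enumerability -/

theorem EnumReducible.medvedevReducible {A B : Set ℕ} (hA : A.Nonempty) (h : EnumReducible A B) :
    MedvedevReducible (enumProblem A) (enumProblem B) := by
  classical
  obtain ⟨a, ha⟩ := hA
  obtain ⟨V, rfl⟩ := h
  obtain ⟨e, he, heV⟩ := V.re.exists_primrec_enum
  -- the output allowed by the option `o` when the elements of `σ` have been enumerated
  let out : Option (ℕ × List ℕ) → List ℕ → ℕ := fun o σ =>
    o.casesOn a fun p => if ∀ d ∈ p.2, d ∈ σ then p.1 else a
  have hout : Primrec₂ out := by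
    refine Primrec.option_casesOn Primrec.fst (Primrec.const a) (Primrec.ite ?_ ?_ ?_)
    · have h : PrimrecRel fun (d : ℕ) (σ : List ℕ) => d ∈ σ :=
        primrecRel_list_mem.comp Primrec.snd Primrec.fst
      exact h.forall_mem_list.comp (Primrec.snd.comp Primrec.snd)
        (Primrec.snd.comp Primrec.fst)
    · exact Primrec.fst.comp Primrec.snd
    · exact Primrec.const a
  -- Input `⟨k, i⟩` tests the `i`-th axiom against the first `k` values of the oracle. Failed tests
  -- output the default `a ∈ A`, which is where nonemptiness enters.
  refine .of_rePred (W := fun x => x.1.length = x.2.1.unpair.1 ∧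
    x.2.2 = out (e x.2.1.unpair.2) x.1) (PrimrecPred.rePred ?_) ?_ ?_
  · have u : Primrec fun x : List ℕ × ℕ × ℕ => x.2.1.unpair :=
      Primrec.unpair.comp (Primrec.fst.comp Primrec.snd)
    exact PrimrecPred.and
      (Primrec.eq.comp (Primrec.list_length.comp Primrec.fst) (Primrec.fst.comp u))
      (Primrec.eq.comp (Primrec.snd.comp Primrec.snd)
        (hout.comp (he.comp (Primrec.snd.comp u)) Primrec.fst))
  · exact fun f _ n => ⟨n.unpair.1,
      out (e n.unpair.2) (initSeg f n.unpair.1), length_initSeg _ _, rfl⟩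
  · intro f hf g hg
    have hg' : ∀ n, g n = out (e n.unpair.2) (initSeg f n.unpair.1) := by
      intro n
      obtain ⟨k, hk, hgn⟩ := hg n
      rw [length_initSeg] at hk
      dsimp only at hk hgn
      rw [hgn, hk]
    have hf : Set.range f = B := hf
    refine Set.Subset.antisymm ?_ ?_
    · rintro _ ⟨n, rfl⟩
      rw [hg']
      cases hn : e n.unpair.2 with
      | none => exact ha
      | some p =>
        by_cases hp : ∀ d ∈ p.2, d ∈ initSeg f n.unpair.1
        · simp only [out, if_pos hp]
          refine ⟨p.2, (heV p).2 ⟨_, hn⟩, fun d hd => ?_⟩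
          obtain ⟨i, -, hi⟩ := mem_initSeg.1 (hp d hd)
          exact hf ▸ ⟨i, hi⟩
        · simp only [out, if_neg hp]
          exact ha
    · rintro x ⟨D, hD, hDB⟩
      obtain ⟨i, hi⟩ := (heV _).1 hD
      obtain ⟨k, hk⟩ := exists_forall_mem_initSeg (f := f) (D := D) (hf ▸ hDB)
      refine ⟨Nat.pair k i, ?_⟩
      rw [hg', Nat.unpair_pair, hi]
      simp only [out]
      rw [if_pos hk]

theorem EnumEquiv.medvedevEquiv {A B : Set ℕ} (hA : A.Nonempty) (hB : B.Nonempty)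
    (h : EnumEquiv A B) : MedvedevEquiv (enumProblem A) (enumProblem B) :=
  ⟨h.1.medvedevReducible hA, h.2.medvedevReducible hB⟩

/-! ### Cototal sets give compact degrees -/

/-- If `B` is cototal via an enumeration operator with axioms `(x, D)`, then choosing for each axiom
an element of `B` in `D ∪ {x}` enumerates `B`; such choices form a compact set. -/
theorem IsCototalSet.exists_isCompact {B : Set ℕ} (hB : B.Nonempty) (h : IsCototalSet B) :
    ∃ C : MassProblem, IsCompact C ∧ MedvedevEquiv (enumProblem B) C := by
  classical
  obtain ⟨b, hb⟩ := hB
  obtain ⟨V, hV⟩ := h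
  obtain ⟨e, he, heV⟩ := V.re.exists_primrec_enum
  let cand : ℕ → List ℕ := fun n => (e n).casesOn [b] fun p => p.1 :: p.2
  have hcand : Primrec cand := Primrec.option_casesOn he (Primrec.const [b])
    (Primrec.list_cons.comp (Primrec.fst.comp Primrec.snd) (Primrec.snd.comp Primrec.snd))
  have hex : ∀ n, ∃ m ∈ cand n, m ∈ B := by
    intro n
    cases hn : e n with
    | none => exact ⟨b, by simp [cand, hn], hb⟩
    | some p =>
      by_cases hp : ∃ d ∈ p.2, d ∈ B
      · obtain ⟨d, hd, hdB⟩ := hp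
        exact ⟨d, by simp [cand, hn, hd], hdB⟩
      · push Not at hp
        refine ⟨p.1, by simp [cand, hn], ?_⟩
        rw [← hV]
        exact ⟨p.2, (heV p).2 ⟨n, hn⟩, hp⟩
  have hall : ∀ x ∈ B, ∃ n, ∀ m ∈ cand n, m ∈ B → m = x := by
    intro x hx
    rw [← hV] at hx
    obtain ⟨D, hD, hDB⟩ := hx
    obtain ⟨n, hn⟩ := (heV _).1 hD
    refine ⟨n, fun m hm hmB => ?_⟩
    simp only [cand, hn, List.mem_cons] at hm
    exact hm.resolve_right fun hmD => hDB m hmD hmB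
  refine ⟨Set.univ.pi fun n => {m | m ∈ cand n ∧ m ∈ B}, ?_, .of_subset ?_, ?_⟩
  · exact isCompact_univ_pi fun n =>
      ((List.finite_toSet (cand n)).subset fun m hm => hm.1).isCompact
  · intro f hf
    refine Set.Subset.antisymm ?_ fun x hx => ?_
    · rintro _ ⟨n, rfl⟩
      exact (hf n trivial).2
    · obtain ⟨n, hn⟩ := hall x hx
      exact ⟨n, hn _ (hf n trivial).1 (hf n trivial).2⟩
  · refine .of_rePred (W := fun x => x.2.2 ∈ cand x.2.1 ∧ x.2.2 ∈ x.1)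
      (PrimrecPred.rePred ?_) ?_ ?_
    · exact PrimrecPred.and
        (primrecRel_list_mem.comp (hcand.comp (Primrec.fst.comp Primrec.snd)) (Primrec.snd.comp Primrec.snd))
        (primrecRel_list_mem.comp Primrec.fst (Primrec.snd.comp Primrec.snd))
    · intro f hf n
      have hf : Set.range f = B := hf
      obtain ⟨m, hm, hmB⟩ := hex n
      obtain ⟨i, rfl⟩ : m ∈ Set.range f := hf ▸ hmB
      exact ⟨i + 1, f i, hm, mem_initSeg.2 ⟨i, i.lt_succ_self, rfl⟩⟩
    · intro f hf g hg n _
      have hf : Set.range f = B := hf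
      obtain ⟨k, hk, hm⟩ := hg n
      obtain ⟨i, -, hi⟩ := mem_initSeg.1 hm
      exact ⟨hk, hf ▸ ⟨i, hi⟩⟩

theorem enumReducible_univ_left (A : Set ℕ) : EnumReducible Set.univ A := by
  refine ⟨⟨Set.univ, PrimrecPred.rePred ?_⟩, ?_⟩
  · exact (Primrec.eq.comp (Primrec.const 0) (Primrec.const 0) : PrimrecPred fun _ => 0 = 0).of_eq
      (by simp)
  · exact Set.eq_univ_of_forall fun x => ⟨[], trivial, by simp⟩

theorem isCototalSet_univ : IsCototalSet Set.univ := enumReducible_univ_left _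

/-- Axioms with empty `D` are the only ones that apply to `∅`, and they apply to every oracle. -/
theorem EnumReducible.of_empty {A : Set ℕ} (h : EnumReducible A ∅) (B : Set ℕ) :
    EnumReducible A B := by
  obtain ⟨Ψ, rfl⟩ := h
  refine ⟨⟨{p | p ∈ Ψ.axs ∧ p.2 = []}, Ψ.re.and (PrimrecPred.rePred
    (Primrec.eq.comp Primrec.snd (Primrec.const [])))⟩, ?_⟩
  ext x
  constructor
  · rintro ⟨D, ⟨hD, rfl : D = []⟩, -⟩
    exact ⟨[], hD, by simp⟩
  · rintro ⟨D, hD, hDe⟩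
    obtain rfl : D = [] := List.eq_nil_iff_forall_not_mem.2 hDe
    exact ⟨[], ⟨hD, rfl⟩, by simp⟩

theorem IsCototalEnumDegree.exists_nonempty {A : Set ℕ} (h : IsCototalEnumDegree (enumDegree A)) :
    ∃ B : Set ℕ, B.Nonempty ∧ IsCototalSet B ∧ EnumEquiv A B := by
  obtain ⟨B, ⟨hBA, hAB⟩, hB⟩ := h
  rcases B.eq_empty_or_nonempty with rfl | hne
  -- If the cototal representative is empty, `A` is recursively enumerable and `Set.univ` represents
  -- the same degree.
  · exact ⟨Set.univ, Set.univ_nonempty, isCototalSet_univ, hAB.of_empty _,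
      enumReducible_univ_left A⟩
  · exact ⟨B, hne, hB, hAB, hBA⟩

theorem IsCototalEnumDegree.isCompactDegree {A : Set ℕ} (hA : A.Nonempty)
    (h : IsCototalEnumDegree (enumDegree A)) : IsCompactDegree (enumerabilityDegree A) := by
  obtain ⟨B, hB, hBc, hAB⟩ := h.exists_nonempty
  obtain ⟨C, hC, hBC⟩ := hBc.exists_isCompact hB
  refine ⟨C, hC, ?_⟩
  rw [enumerabilityDegree, medvedevDegree_eq_iff.2 (hAB.medvedevEquiv hA hB),
    medvedevDegree_eq_iff.2 hBC]

/-! ### Compact mass problems may be taken to consist of binary functions -/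

/-- The characteristic function of the graph of `f`. -/
def graphChar (f : ℕ → ℕ) : ℕ → ℕ :=
  fun j => if f j.unpair.1 = j.unpair.2 then 1 else 0

theorem graphChar_lt_two (f : ℕ → ℕ) (j : ℕ) : graphChar f j < 2 := by
  unfold graphChar
  split_ifs <;> norm_num

theorem continuous_graphChar : Continuous graphChar :=
  continuous_pi fun j =>
    (continuous_of_discreteTopology (f := fun v : ℕ => if v = j.unpair.2 then 1 else 0)).comp
      (continuous_apply j.unpair.1)

/-- Compactness bounds the members of `C` pointwise, but perhaps not computably. Binary values make
the strings of each length a computable finite list. -/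
theorem medvedevReducible_image_graphChar (C : MassProblem) :
    MedvedevReducible (graphChar '' C) C := by
  classical
  refine .of_rePred (W := fun x => x.2.1.unpair.1 < x.1.length ∧
    x.2.2 = if x.1.getD x.2.1.unpair.1 0 = x.2.1.unpair.2 then 1 else 0)
    (PrimrecPred.rePred ?_) ?_ ?_
  · have u : Primrec fun x : List ℕ × ℕ × ℕ => x.2.1.unpair :=
      Primrec.unpair.comp (Primrec.fst.comp Primrec.snd)
    exact PrimrecPred.and
      (Primrec.nat_lt.comp (Primrec.fst.comp u) (Primrec.list_length.comp Primrec.fst))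
      (Primrec.eq.comp (Primrec.snd.comp Primrec.snd) (Primrec.ite (Primrec.eq.comp
        ((Primrec.list_getD 0).comp Primrec.fst (Primrec.fst.comp u)) (Primrec.snd.comp u))
        (Primrec.const 1) (Primrec.const 0)))
  · exact fun f _ n => ⟨n.unpair.1 + 1,
      if (initSeg f (n.unpair.1 + 1)).getD n.unpair.1 0 = n.unpair.2 then 1 else 0, by simp, rfl⟩
  · intro f hf g hg
    refine ⟨f, hf, funext fun n => ?_⟩
    obtain ⟨k, hk, hgn⟩ := hg n
    dsimp only at hk hgn
    rw [length_initSeg] at hk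
    rw [getD_initSeg f hk] at hgn
    exact hgn.symm

theorem image_graphChar_medvedevReducible (C : MassProblem) :
    MedvedevReducible C (graphChar '' C) := by
  refine .of_rePred (W := fun x => x.1[Nat.pair x.2.1 x.2.2]? = some 1)
    (PrimrecPred.rePred ?_) ?_ ?_
  · exact Primrec.eq.comp (Primrec.list_getElem?.comp Primrec.fst
      (Primrec₂.natPair.comp (Primrec.fst.comp Primrec.snd) (Primrec.snd.comp Primrec.snd)))
      (Primrec.const (some 1))
  · rintro _ ⟨f, hf, rfl⟩ n
    exact ⟨Nat.pair n (f n) + 1, f n, by simp [graphChar]⟩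
  · rintro _ ⟨f, hf, rfl⟩ g hg
    have : g = f := by
      funext n
      obtain ⟨k, hk⟩ := hg n
      obtain ⟨hk, h⟩ := List.getElem?_eq_some_iff.1 hk
      simp only [List.getElem_map, List.getElem_range, graphChar, Nat.unpair_pair,
        ite_eq_left_iff, zero_ne_one, imp_false, not_not] at h
      exact h.symm
    exact this ▸ hf

/-! ### Compact degrees of enumerability are cototal -/

/-- All binary strings of length `l`. -/
def binaryStrings (l : ℕ) : List (List ℕ) :=
  l.rec [[]] fun _ L => L.flatMap fun τ => [τ ++ [0], τ ++ [1]]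

theorem primrec_binaryStrings : Primrec binaryStrings := by
  refine (Primrec.nat_rec₁ (f := fun _ (L : List (List ℕ)) =>
    L.flatMap fun τ => [τ ++ [0], τ ++ [1]]) [[]] ?_)
  refine Primrec.list_flatMap Primrec.snd ?_
  exact Primrec.list_cons.comp (Primrec.list_append.comp Primrec.snd (Primrec.const [0]))
    (Primrec.list_cons.comp (Primrec.list_append.comp Primrec.snd (Primrec.const [1]))
      (Primrec.const []))

theorem binaryStrings_succ (l : ℕ) :
    binaryStrings (l + 1) = (binaryStrings l).flatMap fun τ => [τ ++ [0], τ ++ [1]] := rfl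

theorem length_of_mem_binaryStrings {l : ℕ} {τ : List ℕ} (h : τ ∈ binaryStrings l) :
    τ.length = l := by
  induction l generalizing τ with
  | zero =>
    have : τ ∈ [[]] := h
    simp_all
  | succ l ih =>
    rw [binaryStrings_succ, List.mem_flatMap] at h
    obtain ⟨ρ, hρ, h⟩ := h
    have := ih hρ
    simp only [List.mem_cons, List.not_mem_nil, or_false] at h
    rcases h with rfl | rfl <;> simpa

theorem initSeg_mem_binaryStrings {g : ℕ → ℕ} (hg : ∀ n, g n < 2) (l : ℕ) :
    initSeg g l ∈ binaryStrings l := by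
  induction l with
  | zero => exact List.mem_singleton.2 rfl
  | succ l ih =>
    rw [binaryStrings_succ, List.mem_flatMap]
    refine ⟨_, ih, ?_⟩
    have : g l = 0 ∨ g l = 1 := by have := hg l; omega
    rcases this with h | h <;> simp [initSeg, List.range_succ, h]

theorem isOpen_setOf_initSeg (P : List ℕ → Prop) (l : ℕ) :
    IsOpen {g : ℕ → ℕ | P (initSeg g l)} := by
  have hc : Continuous fun (g : ℕ → ℕ) (i : Fin l) => g i :=
    continuous_pi fun i => continuous_apply _
  have : {g : ℕ → ℕ | P (initSeg g l)} =
      (fun (g : ℕ → ℕ) (i : Fin l) => g i) ⁻¹' {v | P (List.ofFn v)} := by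
    ext g
    have : initSeg g l = List.ofFn fun i : Fin l => g i := by
      refine List.ext_getElem (by simp) fun i hi _ => by simp
    simp only [Set.mem_ofPred_eq, Set.mem_preimage, this]
  rw [this]
  exact (isOpen_discrete _).preimage hc

/-! ### Enumeration operators built from Turing functionals -/

namespace TuringFunctional

/-- The enumeration operator taking `A` to the set of codes of strings which `Ψ` computes from
finite strings of elements of `A`. -/
def stringOperator (Ψ : TuringFunctional) : EnumOperator where
  axs := {p | ∃ σ, p.1 = Encodable.encode σ ∧ Ψ.Yields p.2 σ}
  re := REPred.exists ((PrimrecPred.rePred (Primrec.eq.comp (Primrec.fst.comp Primrec.fst)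
    (Primrec.encode.comp Primrec.snd))).and
      (Ψ.rePred_yields.comp ((Primrec.snd.comp Primrec.fst).pair Primrec.snd)))

/-- The enumeration operator taking a set of codes of strings to the set of values which `Φ`
computes from these strings. -/
def valueOperator (Φ : TuringFunctional) : EnumOperator where
  axs := {p | ∃ q : List ℕ × ℕ, p.2 = [Encodable.encode q.1] ∧ (q.1, q.2, p.1) ∈ Φ.axs}
  re := REPred.exists ((PrimrecPred.rePred (Primrec.eq.comp (Primrec.snd.comp Primrec.fst)
    (Primrec.list_cons.comp (Primrec.encode.comp (Primrec.fst.comp Primrec.snd))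
      (Primrec.const [])))).and
      (Φ.re.comp ((Primrec.fst.comp Primrec.snd).pair
        ((Primrec.snd.comp Primrec.snd).pair (Primrec.fst.comp Primrec.fst)))))

/-- `Φ.Enumerates Θ τ x` says that the values which `Φ` computes from initial segments of `τ`
suffice for the enumeration operator `Θ` to enumerate `x`. -/
def Enumerates (Φ : TuringFunctional) (Θ : EnumOperator) (τ : List ℕ) (x : ℕ) : Prop :=
  ∃ D, (x, D) ∈ Θ.axs ∧ ∀ a ∈ D, ∃ q : ℕ × ℕ, (τ.take q.1, q.2, a) ∈ Φ.axs

theorem rePred_enumerates (Φ : TuringFunctional) (Θ : EnumOperator) :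
    REPred fun p : List ℕ × ℕ => Φ.Enumerates Θ p.1 p.2 := by
  have h1 : REPred fun y : ℕ × List ℕ => ∃ q : ℕ × ℕ, (y.2.take q.1, q.2, y.1) ∈ Φ.axs :=
    REPred.exists (Φ.re.comp ((Primrec.list_take.comp (Primrec.fst.comp Primrec.snd)
      (Primrec.snd.comp Primrec.fst)).pair
        ((Primrec.snd.comp Primrec.snd).pair (Primrec.fst.comp Primrec.fst))))
  have h2 := REPred.forall_mem_list (p := fun a (τ : List ℕ) =>
    ∃ q : ℕ × ℕ, (τ.take q.1, q.2, a) ∈ Φ.axs) h1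
  exact REPred.exists ((Θ.re.comp ((Primrec.snd.comp Primrec.fst).pair Primrec.snd)).and
    (h2.comp (Primrec.snd.pair (Primrec.fst.comp Primrec.fst))))

/-- The enumeration operator which enumerates `x` when, for some `l`, every binary string of length
`l` either has its code in the given set or enumerates `x`. -/
def coverOperator (Φ : TuringFunctional) (Θ : EnumOperator) : EnumOperator where
  axs := {p | ∃ l, ∀ τ ∈ binaryStrings l, Encodable.encode τ ∈ p.2 ∨ Φ.Enumerates Θ τ p.1}
  re := by
    have h1 : REPred fun y : List ℕ × ℕ × List ℕ =>
        Encodable.encode y.1 ∈ y.2.2 ∨ Φ.Enumerates Θ y.1 y.2.1 :=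
      (PrimrecPred.rePred (primrecRel_list_mem.comp (Primrec.snd.comp Primrec.snd)
        (Primrec.encode.comp Primrec.fst))).or
        ((Φ.rePred_enumerates Θ).comp (Primrec.fst.pair (Primrec.fst.comp Primrec.snd)))
    have h2 := REPred.forall_mem_list (p := fun (τ : List ℕ) (p : ℕ × List ℕ) =>
      Encodable.encode τ ∈ p.2 ∨ Φ.Enumerates Θ τ p.1) h1
    exact REPred.exists (h2.comp ((primrec_binaryStrings.comp Primrec.snd).pair Primrec.fst))

theorem Enumerates.initSeg_mono {Φ : TuringFunctional} {Θ : EnumOperator} {g : ℕ → ℕ}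
    {k l x : ℕ} (hkl : k ≤ l) (h : Φ.Enumerates Θ (initSeg g k) x) :
    Φ.Enumerates Θ (initSeg g l) x := by
  obtain ⟨D, hD, h⟩ := h
  refine ⟨D, hD, fun a ha => ?_⟩
  obtain ⟨q, hq⟩ := h a ha
  refine ⟨(min q.1 k, q.2), ?_⟩
  rw [take_initSeg] at hq
  rwa [take_initSeg_of_le g ((min_le_right _ _).trans hkl)]

variable {A : Set ℕ} {C : MassProblem} {Φ Ψ : TuringFunctional}

theorem exists_maps_of_encode_mem_apply (hA : A.Nonempty) {σ : List ℕ}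
    (hΨ : ∀ f ∈ enumProblem A, ∃ g ∈ C, Ψ.Maps f g)
    (hσ : Encodable.encode σ ∈ Ψ.stringOperator.apply A) :
    ∃ g ∈ C, σ = initSeg g σ.length := by
  obtain ⟨ρ, ⟨σ', hσσ', hy⟩, hρ⟩ := hσ
  obtain rfl : σ = σ' := Encodable.encode_injective hσσ'
  obtain ⟨f₀, rfl⟩ := A.to_countable.exists_eq_range hA
  -- Prepending `ρ` to an enumeration of `A` gives another enumeration of `A`, since `ρ` has entries
  -- in `A`.
  let f : ℕ → ℕ := fun n => if h : n < ρ.length then ρ[n] else f₀ (n - ρ.length)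
  have hf : f ∈ enumProblem (Set.range f₀) := by
    refine Set.Subset.antisymm ?_ ?_
    · rintro _ ⟨n, rfl⟩
      simp only [f]
      split_ifs with h
      · exact hρ _ (List.getElem_mem h)
      · exact ⟨_, rfl⟩
    · rintro _ ⟨n, rfl⟩
      exact ⟨n + ρ.length, by simp [f]⟩
  have hρf : ρ = initSeg f ρ.length :=
    List.ext_getElem (by simp) fun i hi _ => by simp [f, hi]
  obtain ⟨g, hg, hfg⟩ := hΨ f hf
  rw [hρf] at hy
  exact ⟨g, hg, hy.eq_initSeg hfg⟩

theorem encode_initSeg_mem_apply {f g : ℕ → ℕ} (hf : f ∈ enumProblem A) (hfg : Ψ.Maps f g)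
    (l : ℕ) : Encodable.encode (initSeg g l) ∈ Ψ.stringOperator.apply A := by
  have hf : Set.range f = A := hf
  obtain ⟨k, hk⟩ := hfg.exists_yields l
  refine ⟨initSeg f k, ⟨_, rfl, hk⟩, fun a ha => ?_⟩
  obtain ⟨i, -, hi⟩ := mem_initSeg.1 ha
  exact hf ▸ ⟨i, hi⟩

theorem mem_of_initSeg_mem_axs (hΦ : ∀ g ∈ C, ∃ f ∈ enumProblem A, Φ.Maps g f) {g : ℕ → ℕ}
    (hg : g ∈ C) {k n a : ℕ} (h : (initSeg g k, n, a) ∈ Φ.axs) : a ∈ A := by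
  obtain ⟨f, hf, hgf⟩ := hΦ g hg
  have hf : Set.range f = A := hf
  exact hf ▸ ⟨n, (hgf n).unique ⟨k, h⟩⟩

theorem valueOperator_apply_stringOperator_apply (hA : A.Nonempty)
    (hΨ : ∀ f ∈ enumProblem A, ∃ g ∈ C, Ψ.Maps f g)
    (hΦ : ∀ g ∈ C, ∃ f ∈ enumProblem A, Φ.Maps g f) :
    Φ.valueOperator.apply (Ψ.stringOperator.apply A) = A := by
  refine Set.Subset.antisymm ?_ fun a ha => ?_
  · rintro a ⟨D, ⟨⟨σ, n⟩, hD, hax⟩, hDT⟩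
    dsimp only at hD hax
    subst hD
    obtain ⟨g, hg, hσ⟩ := exists_maps_of_encode_mem_apply hA hΨ (hDT _ List.mem_cons_self)
    rw [hσ] at hax
    exact mem_of_initSeg_mem_axs hΦ hg hax
  · obtain ⟨f₀, hf₀⟩ := A.to_countable.exists_eq_range hA
    obtain ⟨g, hg, hfg⟩ := hΨ f₀ hf₀.symm
    obtain ⟨f, hf, hgf⟩ := hΦ g hg
    have hf : Set.range f = A := hf
    obtain ⟨n, rfl⟩ : a ∈ Set.range f := hf ▸ ha
    obtain ⟨k, hk⟩ := hgf n
    exact ⟨[Encodable.encode (initSeg g k)], ⟨(initSeg g k, n), rfl, hk⟩,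
      by simpa using encode_initSeg_mem_apply hf₀.symm hfg k⟩

/-- Each `g ∈ C` computes an enumeration of `A`, so a finite part of `g` yields the finite set
needed for `x`. These conditions are open and increase with `l`, so compactness gives one `l` for
all of `C`. -/
theorem exists_forall_enumerates_initSeg (hC : IsCompact C)
    (hΦ : ∀ g ∈ C, ∃ f ∈ enumProblem A, Φ.Maps g f) {Θ : EnumOperator} {x : ℕ}
    (hx : x ∈ Θ.apply A) : ∃ l, ∀ g ∈ C, Φ.Enumerates Θ (initSeg g l) x := by
  obtain ⟨D, hD, hDA⟩ := hx
  have hcover : C ⊆ ⋃ l, {g | Φ.Enumerates Θ (initSeg g l) x} := by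
    intro g hg
    obtain ⟨f, hf, hgf⟩ := hΦ g hg
    have hf : Set.range f = A := hf
    choose u hu using hgf
    have hDf : ∀ a ∈ D, a ∈ Set.range f := hf ▸ hDA
    obtain ⟨k, hk⟩ := exists_forall_mem_initSeg hDf
    refine Set.mem_iUnion.2 ⟨(Finset.range k).sup u, D, hD, fun a ha => ?_⟩
    obtain ⟨i, hi, rfl⟩ := mem_initSeg.1 (hk a ha)
    refine ⟨(u i, i), ?_⟩
    rw [take_initSeg_of_le g (Finset.le_sup (f := u) (Finset.mem_range.2 hi))]
    exact hu i
  obtain ⟨l, hl⟩ := hC.elim_directed_cover _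
    (fun l => isOpen_setOf_initSeg (fun τ => Φ.Enumerates Θ τ x) l) hcover
    (directed_of_isDirected_le fun k l hkl g hg => Enumerates.initSeg_mono hkl hg)
  exact ⟨l, hl⟩

theorem isCototalSet_stringOperator_apply (hA : A.Nonempty) (hC : IsCompact C)
    (hC₂ : ∀ g ∈ C, ∀ n, g n < 2) (hΨ : ∀ f ∈ enumProblem A, ∃ g ∈ C, Ψ.Maps f g)
    (hΦ : ∀ g ∈ C, ∃ f ∈ enumProblem A, Φ.Maps g f) :
    IsCototalSet (Ψ.stringOperator.apply A) := by
  classical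
  refine ⟨Φ.coverOperator Ψ.stringOperator, Set.Subset.antisymm ?_ fun x hx => ?_⟩
  · rintro x ⟨D, ⟨l, hl⟩, hD⟩
    obtain ⟨f₀, hf₀⟩ := A.to_countable.exists_eq_range hA
    obtain ⟨g, hg, hfg⟩ := hΨ f₀ hf₀.symm
    have hT := encode_initSeg_mem_apply hf₀.symm hfg l
    -- The initial segment of `g` of length `l` is in the set, so it cannot be excused by `D` and
    -- must enumerate `x`; its values lie in `A` because `g ∈ C`.
    rcases hl _ (initSeg_mem_binaryStrings (hC₂ g hg) l) with h | ⟨E, hE, h⟩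
    · exact absurd hT (hD _ h)
    · refine ⟨E, hE, fun a ha => ?_⟩
      obtain ⟨q, hq⟩ := h a ha
      rw [take_initSeg] at hq
      exact mem_of_initSeg_mem_axs hΦ hg hq
  · obtain ⟨l, hl⟩ := exists_forall_enumerates_initSeg hC hΦ hx
    -- The negative information used is the finite list of strings of length `l` outside the set.
    refine ⟨((binaryStrings l).map Encodable.encode).filter
      (· ∉ Ψ.stringOperator.apply A), ⟨l, fun τ hτ => ?_⟩, fun d hd => ?_⟩
    · by_cases h : Encodable.encode τ ∈ Ψ.stringOperator.apply A
      · obtain ⟨g, hg, hτg⟩ := exists_maps_of_encode_mem_apply hA hΨ h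
        rw [length_of_mem_binaryStrings hτ] at hτg
        exact .inr (hτg ▸ hl g hg)
      · exact .inl (List.mem_filter.2 ⟨List.mem_map_of_mem hτ, by simpa using h⟩)
    · simpa using (List.mem_filter.1 hd).2

end TuringFunctional

theorem isCototalEnumDegree_of_isCompactDegree {A : Set ℕ} (hA : A.Nonempty)
    (h : IsCompactDegree (enumerabilityDegree A)) : IsCototalEnumDegree (enumDegree A) := by
  obtain ⟨C, hC, hAC⟩ := h
  obtain ⟨hle, hge⟩ := medvedevDegree_eq_iff.1 hAC
  obtain ⟨Φ, hΦ⟩ := hle.trans (image_graphChar_medvedevReducible C)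
  obtain ⟨Ψ, hΨ⟩ := (medvedevReducible_image_graphChar C).trans hge
  have hC₂ : ∀ g ∈ graphChar '' C, ∀ n, g n < 2 := by
    rintro _ ⟨f, -, rfl⟩
    exact graphChar_lt_two f
  exact ⟨Ψ.stringOperator.apply A, ⟨⟨_, rfl⟩, _,
    TuringFunctional.valueOperator_apply_stringOperator_apply hA hΨ hΦ⟩,
    TuringFunctional.isCototalSet_stringOperator_apply hA (hC.image continuous_graphChar)
      hC₂ hΨ hΦ⟩

theorem mainTheorem1 :
    (∀ A : Set ℕ, A.Nonempty →
      (IsCompactDegree (enumerabilityDegree A) ↔ IsCototalEnumDegree (enumDegree A))) ∧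
    (∀ d : Set MassProblem, IsDegreeOfEnumerability d →
      (IsCompactDegree d ↔ IsCototalDegreeOfEnumerability d)) := by
  refine ⟨fun A hA => ⟨isCototalEnumDegree_of_isCompactDegree hA,
    IsCototalEnumDegree.isCompactDegree hA⟩, ?_⟩
  rintro _ ⟨A, hA, rfl⟩
  constructor
  · exact fun h => ⟨A, hA, rfl, isCototalEnumDegree_of_isCompactDegree hA h⟩
  · rintro ⟨B, hB, hAB, h⟩
    -- `B` need not be `A`, but compactness depends only on the common Medvedev degree.
    rw [hAB]
    exact h.isCompactDegree hB
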